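/- Let $H$ be a Krull monoid, i.e. a commutative cancellative monoid that has a divisor theory $\varphi\colon H\to\mathcal F(P)$: a monoid homomorphism into the free abelian monoid with basis $P$ such that $\varphi(a)\mid\varphi(b)$ implies $a\mid b$ for all $a,b\in H$, and every element of $\mathcal F(P)$ is the greatest common divisor of $\varphi(X)$ for some finite nonempty $X\subset H$. Let $\mathcal C(H)=\mathsf q(\mathcal F(P))/\mathsf q(\varphi(H))$ be its class group ($\mathsf q$ denoting the quotient group), written additively, and let $G_P=\{[p]: p\in P\}\subset\mathcal C(H)$ be the set of classes containing prime divisors. Suppose that $\mathcal C(H)$ is free abelian with basis $(e_1,\dots,e_r)$ for some $r\ge 2$, that $G_P$ is finite, that $G_P=-G_P$, and that $G_P\supset G_r^+$, where $$G_r^+=\Big\{\sum_{i=1}^r\epsilon_ie_i:\ \epsilon_i\in\{0,1\},\text{ not all } \epsilon_i \text{ equal to } 0\Big\}.$$ For $a\in H$ let $\mathsf L(a)\subset\mathbb N_0$ be the set of all $n$ such that $a$ is, up to a unit, a product of $n$ atoms of $H$. For $k\ge 1$ let $\mathcal U_k(H)=\bigcup_{a\in H,\ k\in\mathsf L(a)}\mathsf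 L(a)$ and $\rho_k(H)=\sup\mathcal U_k(H)$. Let $\mathsf D(G_P)$ be the Davenport constant of $G_P$, i.e. the supremum of the lengths of the minimal zero-sum sequences over $G_P$: the finite nonempty sequences (repetition allowed, order disregarded) of elements of $G_P$ that have sum $0$ and no proper nonempty subsequence with sum $0$. Let $\mathsf F_n$ be the $n$-th Fibonacci number ($\mathsf F_0=0$, $\mathsf F_1=1$). Then $\mathsf D(G_P)<\infty$, and the following hold. 1. There is $M\in\mathbb N_0$ such that, for each $k\ge2$, $\mathcal U_k(H)=L'\cup L^*\cup L''$, where $L^*$ is a finite nonempty interval of integers, $L'\subset\min L^*+[-M,-1]$ and $L''\subset\max L^*+[1,M]$. 2. For each integer $k\ge 1$, $$\rho_{2k}(H)=k\,\mathsf D(G_P)\ge k\,\mathsf F_{r+2}\quad\text{and}\quad k\,\mathsf D(G_P)+1\le\rho_{2k+1}(H)\le k\,\mathsf D(G_P)+\frac{\mathsf D(G_P)}2.$$ -/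

import Mathlib

open scoped Pointwise ENNReal

namespace KrullMonoid

/-! ### Sets of lengths and their unions -/

section Lengths

variable (H : Type*) [CancelCommMonoid H]

/-- The set of lengths of `a`: the lengths of all factorizations of `a` into atoms, a factorization
being a formal (unordered) product of atoms of the reduced monoid `H_red = H / Hˣ` (which is
`Associates H`) whose value is the class of `a`. In a cancellative commutative monoid,
`Irreducible` is exactly the notion of an atom. -/
def lengthSet {H : Type*} [CancelCommMonoid H] (a : H) : Set ℕ :=
  {n | ∃ z : Multiset (Associates H),
    (∀ u ∈ z, Irreducible u) ∧ z.prod = Associates.mk a ∧ Multiset.card z = n}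

open Classical in
/-- The union `U_k(H)` of all sets of lengths of `H` that contain `k`; by convention it is `{k}`
if `H` is a group. -/
noncomputable def unionLengths (k : ℕ) : Set ℕ :=
  if ∀ a : H, IsUnit a then {k} else ⋃ (a : H) (_ : k ∈ lengthSet a), lengthSet a

/-- `ρ_k(H) = sup U_k(H)`. -/
noncomputable def rho (k : ℕ) : ℕ∞ := ⨆ l ∈ unionLengths H k, (l : ℕ∞)

end Lengths

/-! ### Free abelian monoids and divisor theories -/

/-- The (multiplicatively written) free abelian monoid `F(P)` with basis `P`. -/
abbrev FreeAbelianMonoid (P : Type*) : Type _ := Multiplicative (Multiset P)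

/-- The length `|S|` of an element of a free abelian monoid. -/
def FreeAbelianMonoid.length {P : Type*} (S : FreeAbelianMonoid P) : ℕ :=
  Multiset.card (Multiplicative.toAdd S)

/-- The basis element of `F(P)` given by `p`. -/
def FreeAbelianMonoid.prime {P : Type*} (p : P) : FreeAbelianMonoid P :=
  Multiplicative.ofAdd {p}

section DivisorTheory

variable {H D : Type*} [CancelCommMonoid H] [CommMonoid D]

/-- Divisor homomorphisms. -/
def IsDivisorHom (φ : H →* D) : Prop := ∀ a b : H, φ a ∣ φ b → a ∣ b

/-- A divisor theory of `H`: a divisor homomorphism `φ` into a free abelian monoid such that every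
element of the latter is the greatest common divisor of `φ(X)` for a finite nonempty `X ⊆ H`.
(The only unit of a free abelian monoid is `1`, so greatest common divisors are unique.) -/
structure IsDivisorTheory {P : Type*} (φ : H →* FreeAbelianMonoid P) : Prop where
  divisorHom : IsDivisorHom φ
  exists_gcd : ∀ a : FreeAbelianMonoid P, ∃ X : Finset H, X.Nonempty ∧
    (∀ x ∈ X, a ∣ φ x) ∧ ∀ d : FreeAbelianMonoid P, (∀ x ∈ X, d ∣ φ x) → d ∣ a

/-- The quotient group `q(φ(H))` of `φ(H)`, as a subgroup of the quotient group `q(D)` of `D`. -/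
def principalSubgroup (φ : H →* D) : Subgroup (Algebra.GrothendieckGroup D) :=
  Subgroup.closure (Set.range fun a : H => Algebra.GrothendieckGroup.of (φ a))

/-- The class group `C(φ) = q(D) / q(φ(H))`, written additively. If `φ` is a divisor theory of `H`,
this is the class group of `H`. -/
abbrev DivisorClassGroup (φ : H →* D) : Type _ :=
  Additive (Algebra.GrothendieckGroup D ⧸ principalSubgroup φ)

/-- The class `[a]` of an element `a` of `D`. -/
def divisorClass (φ : H →* D) (a : D) : DivisorClassGroup φ :=
  Additive.ofMul (QuotientGroup.mk (Algebra.GrothendieckGroup.of a))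

/-- The set `G_P` of classes containing prime divisors. -/
def primeClasses {P : Type*} (φ : H →* FreeAbelianMonoid P) : Set (DivisorClassGroup φ) :=
  Set.range fun p : P => divisorClass φ (FreeAbelianMonoid.prime p)

end DivisorTheory

/-! ### Zero-sum sequences -/

section ZeroSum

variable {G : Type*} [AddCommGroup G]

/-- The sum `σ(S)` of a sequence `S` over `G₀ ⊆ G`. -/
def seqSum {G₀ : Set G} (S : FreeAbelianMonoid G₀) : G :=
  ((Multiplicative.toAdd S).map (fun g : G₀ => (g : G))).sum

/-- The monoid `B(G₀)` of zero-sum sequences over `G₀`. -/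
def zeroSumMonoid (G₀ : Set G) : Submonoid (FreeAbelianMonoid G₀) where
  carrier := {S | seqSum S = 0}
  one_mem' := by simp [seqSum]
  mul_mem' := by
    intro a b ha hb
    simp only [Set.mem_ofPred_eq, seqSum, toAdd_mul, Multiset.map_add, Multiset.sum_add] at *
    rw [ha, hb, add_zero]

/-- The Davenport constant `D(G₀)`: the supremum of the lengths of the atoms of `B(G₀)`. -/
noncomputable def davenport (G₀ : Set G) : ℕ∞ :=
  ⨆ (U : zeroSumMonoid G₀) (_ : Irreducible U),
    (FreeAbelianMonoid.length (U : FreeAbelianMonoid G₀) : ℕ∞)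

/-- The nonzero vertices `∑ εᵢ eᵢ` of the hypercube spanned by `e₁, …, e_r`, with `εᵢ ∈ {0, 1}` not
all zero. -/
def hypercubeVertices {r : ℕ} (e : Fin r → G) : Set G :=
  {g | ∃ ε : Fin r → ℕ, (∀ i, ε i = 0 ∨ ε i = 1) ∧ (∃ i, ε i ≠ 0) ∧ g = ∑ i, ε i • e i}

end ZeroSum

end KrullMonoid

namespace KrullMonoid

/-! ### Unions of sets of lengths, arithmetically -/

section Arithmetic

variable {R : ℕ → ℕ → Prop}

/-! Let R be the relation between `k` and `l` saying that some element has factorizations of both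
lengths, so that U_k(H) is the fibre of R over `k`. R is symmetric, and it is additive because
factorizations multiply.

A divisor homomorphism identifies H up to units with the multisets of primes whose classes sum to 0,
and its atoms with the minimal zero-sum sequences. Their lengths are bounded because G_P is finite
(`finite_isMinZeroSum`). As G_P = -G_P, for a minimal zero-sum sequence U of length n ≥ 2 the
product U(-U) is also a product of n pairs g(-g), so R(2, n) holds (`sharedLengths_two_card`). In
particular R(2, D) holds for the Davenport constant D. Conversely, counting primes bounds every
shared pair by 2l ≤ kD (`two_mul_le_of_sharedLengths`). These two facts, together with R(1, 1), give
the values and bounds for ρ.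

The hypercube contributes, after adjoining negatives, a minimal zero-sum sequence with Fibonacci
multiplicities and length F_{r+2} (`exists_isMinZeroSum_fibVector`). Restricted to two basis vectors
it has length 3, hence R(2, 3). The pairs (1, 1), (2, 3), (2, D) and their mirror images generate
all of the cone except for bounded margins (`exists_interval_of_rel`). -/

lemma rel_mul (h0 : R 0 0) (hadd : ∀ a b c d, R a b → R c d → R (a + c) (b + d))
    {a b : ℕ} (h : R a b) (n : ℕ) : R (n * a) (n * b) := by
  induction n with
  | zero => simpa using h0
  | succ n ih => simpa [add_mul] using hadd _ _ _ _ ih h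

/-- A pair (2, D) raises `l` over `k` by D - 2 and a pair (2, 3) raises it by 1. Division of l - 2m
by D - 2 says how many of each to take, and pairs (1, 1) fill up the rest. The slack D² ensures that
at most `m` raising pairs are needed. -/
lemma rel_of_le_of_le (h0 : R 0 0) (h1 : R 1 1)
    (hadd : ∀ a b c d, R a b → R c d → R (a + c) (b + d)) (h3 : R 2 3)
    {D : ℕ} (hD : 3 ≤ D) (hD2 : R 2 D) {m l : ℕ} (h : 2 * m ≤ l) (h' : l + D * D ≤ D * m) :
    R (2 * m) l := by
  obtain ⟨d, rfl⟩ : ∃ d, D = d + 2 := ⟨D - 2, by omega⟩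
  have hd : 0 < d := by omega
  obtain ⟨t, rfl⟩ := Nat.exists_eq_add_of_le h
  set i := t / d with hi
  set j := t % d with hj
  have ht : t = d * i + j := (Nat.div_add_mod t d).symm
  have hjd : j < d := Nat.mod_lt _ hd
  have him : i + (d + 2) ≤ m := by
    by_contra hcon
    have : d * m ≤ d * (i + (d + 1)) := Nat.mul_le_mul_left _ (by omega)
    nlinarith
  obtain ⟨q, rfl⟩ := Nat.exists_eq_add_of_le him
  obtain ⟨x, hx⟩ : ∃ x, d + 2 = x + j := ⟨d + 2 - j, by omega⟩
  have key := hadd _ _ _ _ (hadd _ _ _ _ (rel_mul h0 hadd h1 (2 * q)) (rel_mul h0 hadd hD2 i))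
    (hadd _ _ _ _ (rel_mul h0 hadd h1 (2 * x)) (rel_mul h0 hadd h3 j))
  convert key using 1
  · rw [hx]; ring
  · rw [ht, hx]
    have : i * (x + j) = i * d + 2 * i := by rw [← hx]; ring
    rw [this]; ring

/-- For odd `k` one pair (1, 1) is split off. The extra D in the margin pays for it. -/
lemma rel_of_le (h0 : R 0 0) (h1 : R 1 1)
    (hadd : ∀ a b c d, R a b → R c d → R (a + c) (b + d)) (h3 : R 2 3)
    {D : ℕ} (hD : 3 ≤ D) (hD2 : R 2 D) {k l : ℕ} (h : k ≤ l)
    (h' : 2 * l + (2 * (D * D) + D) ≤ D * k) : R k l := by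
  rcases Nat.even_or_odd' k with ⟨m, rfl | rfl⟩
  · exact rel_of_le_of_le h0 h1 hadd h3 hD hD2 h (by nlinarith)
  · obtain ⟨l, rfl⟩ : ∃ l', l = l' + 1 := ⟨l - 1, by omega⟩
    exact hadd _ _ _ _ (rel_of_le_of_le h0 h1 hadd h3 hD hD2 (by omega) (by nlinarith)) h1

/-- A symmetric additive relation on `ℕ` that contains `(1, 1)`, `(2, 3)` and `(2, D)` and is
contained in the cone `2 l ≤ D k` has fibres that are intervals up to uniformly bounded initial
and final parts. -/
lemma exists_interval_of_rel (h0 : R 0 0) (h1 : R 1 1) (hsymm : ∀ a b, R a b → R b a)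
    (hadd : ∀ a b c d, R a b → R c d → R (a + c) (b + d)) (h3 : R 2 3)
    {D : ℕ} (hD : 3 ≤ D) (hD2 : R 2 D) (hle : ∀ k l, R k l → 2 * l ≤ k * D) :
    ∃ M : ℕ, ∀ k : ℕ, ∃ (a b : ℤ) (L' L'' : Set ℤ), a ≤ b ∧
      (Nat.cast '' {l | R k l} : Set ℤ) = L' ∪ Set.Icc a b ∪ L'' ∧
      L' ⊆ Set.Icc (a - M) (a - 1) ∧ L'' ⊆ Set.Icc (b + 1) (b + M) := by
  set K := 2 * (D * D) + D with hK
  have hself : ∀ k, R k k := fun k => by simpa using rel_mul h0 hadd h1 k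
  refine ⟨K + 2, fun k => ?_⟩
  -- `a` is the start of the range below `k` that symmetry and `rel_of_le` reach, or `k` itself if
  -- that range is empty. The `b` that follows plays the same role above `k`.
  obtain ⟨a, hak, ha1, ha2⟩ : ∃ a ≤ k, (∀ l, a ≤ l → l < k → 2 * k + K ≤ D * l) ∧
      D * a ≤ 2 * k + K + D := by
    refine ⟨min k ((2 * k + K) / D + 1), min_le_left _ _, fun l hl hlk => ?_, ?_⟩
    · have : (2 * k + K) / D + 1 ≤ l := by omega
      have h2 := Nat.lt_mul_div_succ (2 * k + K) (show 0 < D by omega)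
      nlinarith
    · have h2 := Nat.mul_div_le (2 * k + K) D
      have := min_le_right k ((2 * k + K) / D + 1)
      nlinarith
  obtain ⟨b, hkb, hb1, hb2⟩ : ∃ b, k ≤ b ∧ (∀ l ≤ b, k < l → 2 * l + K ≤ D * k) ∧
      D * k ≤ 2 * b + K + 1 := by
    refine ⟨max k ((D * k - K) / 2), le_max_left _ _, fun l hl hlk => ?_, ?_⟩
    · omega
    · omega
  have hmem : ∀ l, a ≤ l → l ≤ b → R k l := by
    intro l hal hlb
    rcases lt_trichotomy l k with h | rfl | h
    · exact hsymm _ _ (rel_of_le h0 h1 hadd h3 hD hD2 h.le (ha1 l hal h))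
    · exact hself _
    · exact rel_of_le h0 h1 hadd h3 hD hD2 h.le (hb1 l hlb h)
  refine ⟨a, b, Nat.cast '' {l | R k l ∧ l < a}, Nat.cast '' {l | R k l ∧ b < l},
    by exact_mod_cast hak.trans hkb, ?_, ?_, ?_⟩
  · ext x
    simp only [Set.mem_image, Set.mem_ofPred_eq, Set.mem_union, Set.mem_Icc]
    constructor
    · rintro ⟨l, hl, rfl⟩
      by_cases h : l < a
      · exact Or.inl (Or.inl ⟨l, ⟨hl, h⟩, rfl⟩)
      by_cases h' : b < l
      · exact Or.inr ⟨l, ⟨hl, h'⟩, rfl⟩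
      · exact Or.inl (Or.inr ⟨by omega, by omega⟩)
    · rintro ((⟨l, ⟨hl, -⟩, rfl⟩ | ⟨h, h'⟩) | ⟨l, ⟨hl, -⟩, rfl⟩)
      · exact ⟨l, hl, rfl⟩
      · lift x to ℕ using by omega
        exact ⟨x, hmem x (by omega) (by omega), rfl⟩
      · exact ⟨l, hl, rfl⟩
  · rintro _ ⟨l, ⟨hl, hla⟩, rfl⟩
    -- By symmetry the cone also bounds `l` from below, by 2k ≤ lD, which is within a bounded
    -- distance of `a`.
    have h2 := hle _ _ (hsymm _ _ hl)
    have : a ≤ l + (K + 2) := by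
      by_contra hcon
      push Not at hcon
      have : D * (l + (K + 2)) ≤ D * a := Nat.mul_le_mul_left _ hcon.le
      nlinarith
    simp only [Set.mem_Icc]
    push_cast
    omega
  · rintro _ ⟨l, ⟨hl, hla⟩, rfl⟩
    have h2 := hle _ _ hl
    rw [mul_comm k] at h2
    simp only [Set.mem_Icc]
    push_cast
    omega

end Arithmetic

/-! ### Minimal zero-sum sequences -/

section MinimalZeroSum

variable {G ι κ : Type*} [AddCommGroup G]

/-- The sequence `S` is sent by `c` to a minimal zero-sum sequence. -/
structure IsMinZeroSum (c : ι → G) (S : Multiset ι) : Prop where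
  ne_zero : S ≠ 0
  sum_eq : (S.map c).sum = 0
  eq_of_le : ∀ T ≤ S, (T.map c).sum = 0 → T = 0 ∨ T = S

lemma exists_le_map_eq (f : ι → κ) {S : Multiset ι} {T : Multiset κ} (h : T ≤ S.map f) :
    ∃ T' ≤ S, T'.map f = T := by
  classical
  induction S using Multiset.induction_on generalizing T with
  | empty => exact ⟨0, le_rfl, by simpa [eq_comm] using h⟩
  | cons a S ih =>
    by_cases ha : f a ∈ T
    · obtain ⟨T₁, rfl⟩ := Multiset.exists_cons_of_mem ha
      rw [Multiset.map_cons, Multiset.cons_le_cons_iff] at h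
      obtain ⟨T', hT', rfl⟩ := ih h
      exact ⟨a ::ₘ T', (Multiset.cons_le_cons_iff a).2 hT', by simp⟩
    · rw [Multiset.map_cons, Multiset.le_cons_of_notMem ha] at h
      obtain ⟨T', hT', rfl⟩ := ih h
      exact ⟨T', hT'.trans (Multiset.le_cons_self _ _), rfl⟩

/-- Submultisets of an image lift to submultisets of the source. Minimality can thus be moved freely
between index sets, primes and classes. -/
lemma isMinZeroSum_map (c : κ → G) (f : ι → κ) {S : Multiset ι} :
    IsMinZeroSum c (S.map f) ↔ IsMinZeroSum (fun i => c (f i)) S := by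
  constructor
  · rintro ⟨h1, h2, h3⟩
    refine ⟨by simpa using h1, by simpa [Multiset.map_map] using h2, fun T hT hs => ?_⟩
    rcases h3 (T.map f) (Multiset.map_le_map hT) (by simpa [Multiset.map_map] using hs) with h | h
    · exact Or.inl (by simpa using h)
    · exact Or.inr (Multiset.eq_of_le_of_card_le hT (by simpa using (congrArg Multiset.card h).ge))
  · rintro ⟨h1, h2, h3⟩
    refine ⟨by simpa using h1, by simpa [Multiset.map_map] using h2, fun T hT hs => ?_⟩
    obtain ⟨T, hT', rfl⟩ := exists_le_map_eq f hT
    rcases h3 T hT' (by simpa [Multiset.map_map] using hs) with rfl | rfl <;> simp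

lemma IsMinZeroSum.neg {c : ι → G} {S : Multiset ι} (h : IsMinZeroSum c S) :
    IsMinZeroSum (fun i => -c i) S :=
  ⟨h.1, by simp [h.2], fun T hT hs =>
    h.3 T hT (by simpa [Multiset.sum_map_neg'] using hs)⟩

lemma IsMinZeroSum.eq_singleton {c : ι → G} {S : Multiset ι} (h : IsMinZeroSum c S) {i : ι}
    (hi : i ∈ S) (hc : c i = 0) : S = {i} := by
  rcases h.3 {i} (by simpa using hi) (by simpa using hc) with h | h
  · simp at h
  · exact h.symm

lemma isMinZeroSum_pair {c : ι → G} {i j : ι} (hi : c i ≠ 0) (hij : c i + c j = 0) :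
    IsMinZeroSum c {i, j} := by
  refine ⟨by simp, by simpa using hij, fun T hT hs => ?_⟩
  have hj : c j ≠ 0 := fun h => hi (by simpa [h] using hij)
  have hcard := Multiset.card_le_card hT
  rw [Multiset.card_pair] at hcard
  obtain h | h | h : Multiset.card T = 0 ∨ Multiset.card T = 1 ∨ Multiset.card T = 2 := by omega
  · exact Or.inl (Multiset.card_eq_zero.1 h)
  · obtain ⟨x, rfl⟩ := Multiset.card_eq_one.1 h
    have hx : x ∈ ({i, j} : Multiset ι) := by simpa using hT
    have hx' : c x = 0 := by simpa using hs
    rcases (by simpa using hx : x = i ∨ x = j) with rfl | rfl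
    · exact absurd hx' hi
    · exact absurd hx' hj
  · exact Or.inr (Multiset.eq_of_le_of_card_le hT (by simp [h]))

/-- Dickson's lemma for minimal zero-sum sequences. -/
lemma finite_isMinZeroSum [Finite ι] (c : ι → G) : {S | IsMinZeroSum c S}.Finite := by
  classical
  let f : Multiset ι → ι → ℕ := fun S i => S.count i
  have hf : Function.Injective f := fun S T h => Multiset.ext.2 fun i => congrFun h i
  refine Set.Finite.of_finite_image (f := f) ?_ hf.injOn
  -- Minimal zero-sum sequences are pairwise incomparable, and ℕ^ι is well-quasi-ordered for finite
  -- ι.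
  refine IsAntichain.finite_of_partiallyWellOrderedOn (r := (· ≤ ·)) ?_ (Set.isPWO_of_wellQuasiOrderedLE _)
  rintro _ ⟨S, hS, rfl⟩ _ ⟨T, hT, rfl⟩ hne hle
  rcases hT.3 S (Multiset.le_iff_count.2 hle) hS.2 with h | h
  · exact hS.1 h
  · exact hne (by rw [h])

end MinimalZeroSum

/-! ### A long minimal zero-sum sequence in the symmetric hypercube -/

section Fibonacci

/-- Incidence of the coordinate `j` in the `n`-th vector of the Fibonacci sequence. -/
def fibIncidence (n j : ℕ) : ℕ := if n = j + 1 ∨ (n ≤ j ∧ Even (n + j)) then 1 else 0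

/-- Multiplicities of the Fibonacci sequence. -/
def fibMult (n : ℕ) : ℕ := if n = 0 then 1 else Nat.fib n

/-- Passing from j to j + 2 keeps the parity class and adds only the term F_{j+2}, so this is the
Fibonacci recursion. The value 1 of `fibMult` at 0 starts the even case. -/
lemma sum_fibMult (j : ℕ) :
    ∑ n ∈ Finset.range (j + 1), (if Even (n + j) then fibMult n else 0) = Nat.fib (j + 1) := by
  induction j using Nat.twoStepInduction with
  | zero => simp [fibMult]
  | one => simp [Finset.sum_range_succ, fibMult]
  | more j ih _ =>
    rw [Finset.sum_range_succ, Finset.sum_range_succ, show j + 2 + 1 = j + 1 + 2 by ring,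
      Nat.fib_add_two, ← ih]
    have h1 : ¬ Even (j + 1 + (j + 2)) := by rw [Nat.not_even_iff_odd]; exact ⟨j + 1, by ring⟩
    have h2 : Even (j + 2 + (j + 2)) := ⟨j + 2, rfl⟩
    rw [if_neg h1, if_pos h2, add_zero]
    congr 1
    · exact Finset.sum_congr rfl fun n _ => by
        simp [← add_assoc, Nat.even_add_one]

/-- Coordinate `j` occurs in the vectors n ≤ j of the parity of `j`, with sign (-1)^j, and in the
vector j + 1, with the opposite sign. By `sum_fibMult` the former contribute F_{j+1} in total, which
is the multiplicity of the latter. -/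
lemma sum_fibMult_mul_fibIncidence {r j : ℕ} (hj : j < r) :
    ∑ n ∈ Finset.range (r + 1), (fibMult n : ℤ) * ((-1) ^ n * fibIncidence n j) = 0 := by
  have hsub : Finset.range (j + 2) ⊆ Finset.range (r + 1) :=
    Finset.range_subset_range.2 (by omega)
  rw [← Finset.sum_subset hsub, Finset.sum_range_succ]
  · have h : ∀ n ∈ Finset.range (j + 1), (fibMult n : ℤ) * ((-1) ^ n * fibIncidence n j)
        = (-1) ^ j * ((if Even (n + j) then fibMult n else 0 : ℕ) : ℤ) := by
      intro n hn
      rw [Finset.mem_range] at hn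
      by_cases he : Even (n + j)
      · have : ((-1 : ℤ)) ^ n = (-1) ^ j := by
          rcases Nat.even_or_odd n with h | h
          · rw [h.neg_one_pow, ((Nat.even_add.1 he).1 h).neg_one_pow]
          · rw [h.neg_one_pow, ((Nat.even_add'.1 he).1 h).neg_one_pow]
        have h2 : fibIncidence n j = 1 := if_pos (Or.inr ⟨by omega, he⟩)
        rw [h2, this, if_pos he]; push_cast; ring
      · have h2 : fibIncidence n j = 0 := if_neg fun h => h.elim (by omega) fun h => he h.2
        rw [h2, if_neg he]; simp
    rw [Finset.sum_congr rfl h, ← Finset.mul_sum, ← Nat.cast_sum, sum_fibMult]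
    have h2 : fibIncidence (j + 1) j = 1 := if_pos (Or.inl rfl)
    rw [h2, fibMult, if_neg (by omega)]
    push_cast; ring
  · intro n _ hn
    rw [Finset.mem_range] at hn
    have h2 : fibIncidence n j = 0 := if_neg (by omega)
    simp [h2]

variable {G : Type*} [AddCommGroup G]

/-- The vectors of the Fibonacci sequence. -/
def fibVector {r : ℕ} (e : Fin r → G) (n : Fin (r + 1)) : G :=
  ∑ j : Fin r, ((-1) ^ (n : ℕ) * (fibIncidence n j : ℤ)) • e j

lemma fibVector_mem {r : ℕ} (hr : 1 ≤ r) (e : Fin r → G) (n : Fin (r + 1)) :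
    fibVector e n ∈ hypercubeVertices e ∪ -hypercubeVertices e := by
  have hmem : ∑ j : Fin r, fibIncidence n j • e j ∈ hypercubeVertices e := by
    refine ⟨fun j => fibIncidence n j, fun j => ?_, ?_, rfl⟩
    · dsimp only [fibIncidence]; split_ifs <;> simp
    · by_cases hn : (n : ℕ) = 0
      · exact ⟨⟨0, hr⟩, by simp [fibIncidence, hn]⟩
      · exact ⟨⟨n - 1, by omega⟩, by
          have : (n : ℕ) = n - 1 + 1 := by omega
          have h1 : fibIncidence n (n - 1) = 1 := if_pos (Or.inl this)
          exact h1.trans_ne one_ne_zero⟩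
  rcases Nat.even_or_odd (n : ℕ) with h | h
  · left
    simpa [fibVector, h.neg_one_pow] using hmem
  · right
    simpa [fibVector, h.neg_one_pow] using hmem

lemma sum_map_fibVector {r : ℕ} (e : Fin r → G) (T : Multiset (Fin (r + 1))) :
    (T.map (fibVector e)).sum =
      ∑ j : Fin r, (∑ n : Fin (r + 1), (T.count n : ℤ) * ((-1) ^ (n : ℕ) * fibIncidence n j)) • e j := by
  have h : (T.map (fibVector e)).sum = ∑ n, T.count n • fibVector e n := by
    rw [Finset.sum_multiset_map_count]
    exact Finset.sum_subset (Finset.subset_univ _) fun n _ hn => by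
      rw [Multiset.mem_toFinset] at hn
      simp [Multiset.count_eq_zero_of_notMem hn]
  rw [h]
  simp only [fibVector, Finset.smul_sum, Finset.sum_smul]
  rw [Finset.sum_comm]
  refine Finset.sum_congr rfl fun j _ => Finset.sum_congr rfl fun n _ => ?_
  rw [← natCast_zsmul, smul_smul]

/-- The system is triangular: among vectors of index at least j + 1, only the vector j + 1 involves
coordinate `j`, so its multiplicity is determined by those of smaller index. Every zero-sum sequence
is therefore a multiple of `S`, the factor being the multiplicity of vector 0, which is 1 in `S`. -/
lemma exists_isMinZeroSum_fibVector {r : ℕ} {e : Fin r → G} (he : LinearIndependent ℤ e) :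
    ∃ S : Multiset (Fin (r + 1)), IsMinZeroSum (fibVector e) S ∧
      Multiset.card S = Nat.fib (r + 2) := by
  classical
  set S : Multiset (Fin (r + 1)) := ∑ n : Fin (r + 1), Multiset.replicate (fibMult n) n with hS
  have hcount : ∀ n, S.count n = fibMult n := by
    intro n
    simp [hS, Multiset.count_sum', Multiset.count_replicate]
  have hrel : ∀ j : Fin r, ∑ n : Fin (r + 1),
      (fibMult n : ℤ) * ((-1) ^ (n : ℕ) * fibIncidence n j) = 0 := fun j => by
    rw [Fin.sum_univ_eq_sum_range (fun n => (fibMult n : ℤ) * ((-1) ^ n * fibIncidence n j))]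
    exact sum_fibMult_mul_fibIncidence j.2
  have hrig : ∀ T : Multiset (Fin (r + 1)), (T.map (fibVector e)).sum = 0 →
      ∀ n, T.count n = T.count 0 * fibMult n := by
    intro T hT
    rw [sum_map_fibVector] at hT
    have hj := Fintype.linearIndependent_iff.1 he _ hT
    -- The deviation from the expected multiple of `S` solves the same homogeneous system and
    -- vanishes at 0, so by triangularity it vanishes everywhere.
    set d : Fin (r + 1) → ℤ := fun n => (T.count n : ℤ) - T.count 0 * fibMult n with hd
    have hdrel : ∀ j : Fin r, ∑ n : Fin (r + 1), d n * ((-1) ^ (n : ℕ) * fibIncidence n j) = 0 := by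
      intro j
      simp only [hd, sub_mul, Finset.sum_sub_distrib, mul_assoc, ← Finset.mul_sum]
      rw [hj j, hrel j]; simp
    have hd0 : ∀ N : ℕ, ∀ n : Fin (r + 1), (n : ℕ) = N → d n = 0 := by
      intro N
      induction N using Nat.strong_induction_on with
      | _ N ih =>
        intro n hn
        rcases Nat.eq_zero_or_pos N with h0 | hpos
        · have : n = 0 := Fin.ext (by simp [hn, h0])
          subst this
          simp [hd, fibMult]
        · have h := hdrel ⟨N - 1, by omega⟩
          rw [Finset.sum_eq_single n] at h
          · have h1 : fibIncidence n (N - 1) = 1 := if_pos (Or.inl (by omega))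
            simpa [h1] using h
          · intro b _ hb
            have hb' : (b : ℕ) ≠ N := fun h => hb (Fin.ext (h.trans hn.symm))
            by_cases hbN : (b : ℕ) < N
            · rw [ih b hbN b rfl, zero_mul]
            · have h1 : fibIncidence b (N - 1) = 0 := if_neg (by omega)
              simp [h1]
          · simp
    intro n
    have := hd0 n n rfl
    simp only [hd] at this
    exact_mod_cast sub_eq_zero.1 this
  have hcard : Multiset.card S = Nat.fib (r + 2) := by
    rw [hS, Multiset.card_sum]
    simp only [Multiset.card_replicate]
    -- F_{r+2} = 1 + F_0 + ... + F_r, and the summand 1 is the multiplicity at index 0, where F_0 =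
    -- 0.
    rw [Fin.sum_univ_eq_sum_range fibMult, Nat.fib_succ_eq_succ_sum, Finset.sum_range_succ',
      Finset.sum_range_succ']
    simp [fibMult]
  refine ⟨S, ⟨?_, ?_, fun T hT hs => ?_⟩, hcard⟩
  · intro h
    have := hcount 0
    simp [h, fibMult] at this
  · rw [sum_map_fibVector]
    simp only [hcount]
    exact Finset.sum_eq_zero fun j _ => by rw [hrel j, zero_smul]
  · have h := hrig T hs
    have h0 : T.count 0 ≤ 1 := by
      simpa [hcount, fibMult] using Multiset.le_iff_count.1 hT 0
    rcases Nat.le_one_iff_eq_zero_or_eq_one.1 h0 with h0 | h0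
    · exact Or.inl (Multiset.ext.2 fun n => by rw [h n, h0]; simp)
    · exact Or.inr (Multiset.ext.2 fun n => by rw [h n, h0, hcount, one_mul])

end Fibonacci

/-! ### Minimal zero-sum sequences and the Davenport constant -/

section Davenport

variable {G : Type*} [AddCommGroup G] {G₀ : Set G}

/-- The complement of a zero-sum subsequence of a zero-sum sequence has sum 0, so such subsequences
are exactly the divisors in the monoid. -/
lemma irreducible_zeroSumMonoid_iff (U : zeroSumMonoid G₀) :
    Irreducible U ↔ IsMinZeroSum (fun g : G₀ => (g : G))
      (Multiplicative.toAdd (U : FreeAbelianMonoid G₀)) := by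
  have hunit : ∀ V : zeroSumMonoid G₀,
      IsUnit V ↔ Multiplicative.toAdd (V : FreeAbelianMonoid G₀) = 0 := by
    intro V
    constructor
    · rintro h
      obtain ⟨W, hW⟩ := h.exists_right_inv
      have h1 : Multiplicative.toAdd (V : FreeAbelianMonoid G₀) +
          Multiplicative.toAdd (W : FreeAbelianMonoid G₀) = 0 :=
        congrArg (fun X : zeroSumMonoid G₀ => Multiplicative.toAdd (X : FreeAbelianMonoid G₀)) hW
      exact (add_eq_zero.1 h1).1
    · intro h
      have : V = 1 := Subtype.ext h
      rw [this]; exact isUnit_one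
  constructor
  · intro hU
    refine ⟨fun h => hU.not_isUnit ((hunit U).2 h), U.2, fun T hT hs => ?_⟩
    obtain ⟨T', hT'⟩ := Multiset.le_iff_exists_add.1 hT
    have hs' : (T'.map (fun g : G₀ => (g : G))).sum = 0 := by
      have := U.2
      change ((Multiplicative.toAdd (U : FreeAbelianMonoid G₀)).map _).sum = 0 at this
      rw [hT', Multiset.map_add, Multiset.sum_add, hs, zero_add] at this
      exact this
    have hmul : U = ⟨Multiplicative.ofAdd T, hs⟩ * ⟨Multiplicative.ofAdd T', hs'⟩ :=
      Subtype.ext hT'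
    rcases hU.isUnit_or_isUnit hmul with h | h
    · exact Or.inl ((hunit _).1 h)
    · have h0 : T' = 0 := (hunit _).1 h
      exact Or.inr (by rw [hT', h0, add_zero])
  · intro hU
    refine ⟨fun h => hU.1 ((hunit U).1 h), fun V W hVW => ?_⟩
    have hadd : Multiplicative.toAdd (U : FreeAbelianMonoid G₀) =
        Multiplicative.toAdd (V : FreeAbelianMonoid G₀) +
          Multiplicative.toAdd (W : FreeAbelianMonoid G₀) := by
      rw [hVW]; rfl
    rcases hU.3 _ (hadd ▸ Multiset.le_add_right _ _) V.2 with h | h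
    · exact Or.inl ((hunit V).2 h)
    · refine Or.inr ((hunit W).2 ?_)
      rw [← h] at hadd
      simpa using hadd

/-- If `c` has finite range, the Davenport constant of the range is the maximal length of
a minimal zero-sum sequence. -/
lemma exists_davenport_eq {ι : Type*} (c : ι → G) (hfin : (Set.range c).Finite)
    (hne : ∃ S, IsMinZeroSum c S) :
    ∃ D : ℕ, davenport (Set.range c) = D ∧ (∀ S, IsMinZeroSum c S → Multiset.card S ≤ D) ∧
      ∃ S, IsMinZeroSum c S ∧ Multiset.card S = D := by
  have : Finite (Set.range c) := hfin
  have hpush : ∀ S, IsMinZeroSum c S →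
      IsMinZeroSum (fun g : Set.range c => (g : G)) (S.map (Set.rangeFactorization c)) :=
    fun S hS => (isMinZeroSum_map _ _).2 hS
  have hpull : ∀ S, IsMinZeroSum (fun g : Set.range c => (g : G)) S →
      ∃ S', IsMinZeroSum c S' ∧ Multiset.card S' = Multiset.card S := by
    intro S hS
    -- One index is chosen for each class. Distinct indices may share a class, but lengths and sums
    -- are unaffected.
    let s : Set.range c → ι := fun g => g.2.choose
    have hs : ∀ g, c (s g) = g := fun g => g.2.choose_spec
    refine ⟨S.map s, (isMinZeroSum_map _ _).2 ?_, by simp⟩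
    simpa only [hs] using hS
  set A : Set (Multiset ι) := {S | IsMinZeroSum c S} with hA
  have hAne : (Multiset.card '' A).Nonempty := by
    obtain ⟨S, hS⟩ := hne
    exact ⟨_, S, hS, rfl⟩
  have hfin' : (Multiset.card '' A).Finite := by
    refine ((finite_isMinZeroSum (fun g : Set.range c => (g : G))).image Multiset.card).subset ?_
    rintro _ ⟨S, hS, rfl⟩
    exact ⟨_, hpush S hS, by simp⟩
  obtain ⟨D, ⟨S, hS, hSD⟩, hmax⟩ := hfin'.exists_maximal hAne
  have hmax' : ∀ S, IsMinZeroSum c S → Multiset.card S ≤ D := fun S hS => by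
    by_contra hcon
    exact hcon (hmax ⟨S, hS, rfl⟩ (not_le.1 hcon).le)
  refine ⟨D, le_antisymm ?_ ?_, hmax', S, hS, hSD⟩
  · refine iSup₂_le fun U hU => ?_
    obtain ⟨S', hS', hc⟩ := hpull _ ((irreducible_zeroSumMonoid_iff U).1 hU)
    rw [FreeAbelianMonoid.length, ← hc]
    exact_mod_cast hmax' S' hS'
  · let U : zeroSumMonoid (Set.range c) :=
      ⟨Multiplicative.ofAdd (S.map (Set.rangeFactorization c)), (hpush S hS).2⟩
    have hU : Irreducible U := (irreducible_zeroSumMonoid_iff U).2 (hpush S hS)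
    refine le_iSup₂_of_le U hU ?_
    have : FreeAbelianMonoid.length (U : FreeAbelianMonoid (Set.range c)) = D := by
      rw [← hSD]; exact Multiset.card_map _ _
    rw [this]

end Davenport

/-! ### Factorizations -/

section Factorizations

variable {H : Type*} [CancelCommMonoid H]

lemma associated_of_mutual_dvd {a b : H} (h : a ∣ b) (h' : b ∣ a) : Associated a b := by
  obtain ⟨c, rfl⟩ := h
  obtain ⟨d, hd⟩ := h'
  have hcd : c * d = 1 := by
    rw [mul_assoc] at hd
    exact (mul_eq_left.1 hd.symm)
  exact ⟨⟨c, d, hcd, by rw [mul_comm, hcd]⟩, rfl⟩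

lemma irreducible_associatesMk_iff {a : H} : Irreducible (Associates.mk a) ↔ Irreducible a := by
  simp only [irreducible_iff, Associates.isUnit_mk]
  refine and_congr_right fun _ => ⟨fun h x y hxy => ?_, fun h => ?_⟩
  · simpa using @h (Associates.mk x) (Associates.mk y) (by rw [hxy, Associates.mk_mul_mk])
  · refine Quotient.ind fun x => Quotient.ind fun y => ?_
    intro hxy
    change Associates.mk a = Associates.mk x * Associates.mk y at hxy
    rw [Associates.mk_mul_mk, Associates.mk_eq_mk_iff_associated] at hxy
    obtain ⟨u, hu⟩ := hxy.symm
    change IsUnit (Associates.mk x) ∨ IsUnit (Associates.mk y)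
    rw [Associates.isUnit_mk, Associates.isUnit_mk]
    rcases h (show a = x * (y * u) by rw [← hu, mul_assoc]) with h | h
    · exact Or.inl h
    · exact Or.inr (isUnit_of_mul_isUnit_left h)

lemma mem_lengthSet_iff {a : H} {n : ℕ} : n ∈ lengthSet a ↔
    ∃ z : Multiset H, (∀ u ∈ z, Irreducible u) ∧ Associated z.prod a ∧ Multiset.card z = n := by
  constructor
  · rintro ⟨z, hz, hprod, hcard⟩
    refine ⟨z.map Quotient.out, fun u hu => ?_, ?_, by simpa using hcard⟩
    · obtain ⟨v, hv, rfl⟩ := Multiset.mem_map.1 hu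
      rw [← irreducible_associatesMk_iff]
      convert hz v hv
      exact Quotient.out_eq v
    · rw [← Associates.mk_eq_mk_iff_associated, ← hprod, ← Associates.prod_mk, Multiset.map_map]
      congr 1
      conv_rhs => rw [← Multiset.map_id z]
      exact Multiset.map_congr rfl fun v _ => Quotient.out_eq v
  · rintro ⟨z, hz, hprod, hcard⟩
    refine ⟨z.map Associates.mk, fun u hu => ?_, ?_, by simpa using hcard⟩
    · obtain ⟨v, hv, rfl⟩ := Multiset.mem_map.1 hu
      exact irreducible_associatesMk_iff.2 (hz v hv)
    · rw [Associates.prod_mk, Associates.mk_eq_mk_iff_associated.2 hprod]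

variable (H) in
/-- Some element of `H` has factorizations of lengths `k` and `l`. -/
def SharedLengths (k l : ℕ) : Prop := ∃ a : H, k ∈ lengthSet a ∧ l ∈ lengthSet a

lemma SharedLengths.symm {k l : ℕ} (h : SharedLengths H k l) : SharedLengths H l k :=
  h.imp fun _ h => h.symm

lemma sharedLengths_zero : SharedLengths H 0 0 := by
  have : 0 ∈ lengthSet (1 : H) := ⟨0, by simp, by simp, rfl⟩
  exact ⟨1, this, this⟩

lemma mul_mem_lengthSet {a b : H} {m n : ℕ} (ha : m ∈ lengthSet a) (hb : n ∈ lengthSet b) :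
    m + n ∈ lengthSet (a * b) := by
  obtain ⟨z, hz, hp, rfl⟩ := ha
  obtain ⟨w, hw, hq, rfl⟩ := hb
  refine ⟨z + w, fun u hu => ?_, by rw [Multiset.prod_add, hp, hq, Associates.mk_mul_mk], by simp⟩
  rcases Multiset.mem_add.1 hu with h | h
  exacts [hz u h, hw u h]

lemma SharedLengths.add (a b c d : ℕ) (h : SharedLengths H a b) (h' : SharedLengths H c d) :
    SharedLengths H (a + c) (b + d) := by
  obtain ⟨x, hx, hx'⟩ := h
  obtain ⟨y, hy, hy'⟩ := h'
  exact ⟨x * y, mul_mem_lengthSet hx hy, mul_mem_lengthSet hx' hy'⟩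

lemma sharedLengths_of_associated {z w : Multiset H} (hz : ∀ u ∈ z, Irreducible u)
    (hw : ∀ u ∈ w, Irreducible u) (h : Associated z.prod w.prod) :
    SharedLengths H (Multiset.card z) (Multiset.card w) :=
  ⟨w.prod, mem_lengthSet_iff.2 ⟨z, hz, h, rfl⟩, mem_lengthSet_iff.2 ⟨w, hw, Associated.refl _, rfl⟩⟩

/-- An atom rules out the group case, for which U_k is defined by convention. -/
lemma unionLengths_eq (hH : ∃ a : H, Irreducible a) (k : ℕ) :
    unionLengths H k = {l | SharedLengths H k l} := by
  obtain ⟨a, ha⟩ := hH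
  rw [unionLengths, if_neg fun h => ha.not_isUnit (h a)]
  ext l
  simp [SharedLengths]

end Factorizations

/-! ### Divisor homomorphisms into free abelian monoids -/

section Transfer

variable {H P : Type*} [CancelCommMonoid H] {φ : H →* FreeAbelianMonoid P}

/-- The class of a prime divisor. -/
def primeClass (φ : H →* FreeAbelianMonoid P) (p : P) : DivisorClassGroup φ :=
  divisorClass φ (FreeAbelianMonoid.prime p)

lemma divisorClass_ofAdd (φ : H →* FreeAbelianMonoid P) (A : Multiset P) :
    divisorClass φ (Multiplicative.ofAdd A) = (A.map (primeClass φ)).sum := by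
  induction A using Multiset.induction_on with
  | empty => simp [divisorClass]
  | cons p A ih =>
    rw [Multiset.map_cons, Multiset.sum_cons, ← ih, ← Multiset.singleton_add, ofAdd_add]
    simp [divisorClass, primeClass, FreeAbelianMonoid.prime]

lemma exists_mul_eq_of_mem_principalSubgroup {D : Type*} [CommMonoid D] (ψ : H →* D)
    {x : Algebra.GrothendieckGroup D} (hx : x ∈ principalSubgroup ψ) :
    ∃ a b : H, x * Algebra.GrothendieckGroup.of (ψ b) = Algebra.GrothendieckGroup.of (ψ a) := by
  induction hx using Subgroup.closure_induction with
  | mem x hx =>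
    obtain ⟨a, rfl⟩ := hx
    exact ⟨a, 1, by simp⟩
  | one => exact ⟨1, 1, one_mul _⟩
  | mul x y _ _ hx hy =>
    obtain ⟨a, b, h⟩ := hx
    obtain ⟨a', b', h'⟩ := hy
    refine ⟨a * a', b * b', ?_⟩
    rw [map_mul, map_mul, map_mul, map_mul, ← h, ← h']
    exact mul_mul_mul_comm ..
  | inv x _ hx =>
    obtain ⟨a, b, h⟩ := hx
    exact ⟨b, a, by rw [← h, inv_mul_cancel_left]⟩

/-- The zero-sum condition characterizes the image of a divisor homomorphism. -/
lemma sum_primeClass_eq_zero_iff (hφ : IsDivisorHom φ) (A : Multiset P) :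
    (A.map (primeClass φ)).sum = 0 ↔ ∃ a : H, φ a = Multiplicative.ofAdd A := by
  rw [← divisorClass_ofAdd]
  constructor
  · intro h
    have hmem : Algebra.GrothendieckGroup.of (Multiplicative.ofAdd A) ∈ principalSubgroup φ :=
      (QuotientGroup.eq_one_iff _).1 (ofMul_eq_zero.1 h)
    obtain ⟨a, b, hab⟩ := exists_mul_eq_of_mem_principalSubgroup φ hmem
    rw [← map_mul] at hab
    have hab' := Algebra.GrothendieckGroup.of_injective hab
    -- A trivial class means that A φ(b) = φ(a). The divisor property gives b ∣ a, and the quotient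
    -- has image A.
    obtain ⟨c, rfl⟩ := hφ b a ⟨Multiplicative.ofAdd A, by rw [← hab', mul_comm]⟩
    refine ⟨c, ?_⟩
    rw [map_mul, mul_comm] at hab'
    exact (mul_left_cancel hab').symm
  · rintro ⟨a, ha⟩
    rw [← ha]
    exact ofMul_eq_zero.2 ((QuotientGroup.eq_one_iff _).2 (Subgroup.subset_closure ⟨a, rfl⟩))

lemma associated_of_map_eq (hφ : IsDivisorHom φ) {a b : H} (h : φ a = φ b) : Associated a b :=
  associated_of_mutual_dvd (hφ _ _ (dvd_of_eq h)) (hφ _ _ (dvd_of_eq h.symm))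

/-- The multiset of prime divisors of `a`. -/
def divisors (φ : H →* FreeAbelianMonoid P) (a : H) : Multiset P := Multiplicative.toAdd (φ a)

lemma divisors_mul (a b : H) : divisors φ (a * b) = divisors φ a + divisors φ b := by
  simp [divisors]

lemma divisors_prod (z : Multiset H) : divisors φ z.prod = (z.map (divisors φ)).sum := by
  induction z using Multiset.induction_on with
  | empty => simp [divisors]
  | cons a z ih => simp [divisors_mul, ih]

lemma divisors_eq_zero_iff (hφ : IsDivisorHom φ) {a : H} : divisors φ a = 0 ↔ IsUnit a := by
  constructor
  · intro h
    have h1 : φ a = φ 1 := by rw [map_one]; exact h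
    exact (associated_of_map_eq hφ h1).symm.isUnit isUnit_one
  · intro h
    obtain ⟨b, hb⟩ := h.exists_right_inv
    have := divisors_mul (φ := φ) a b
    rw [hb] at this
    have h0 : divisors φ a + divisors φ b = 0 := by rw [← this]; simp [divisors]
    exact (add_eq_zero.1 h0).1

lemma exists_divisors_eq (hφ : IsDivisorHom φ) {A : Multiset P}
    (hA : (A.map (primeClass φ)).sum = 0) : ∃ a : H, divisors φ a = A := by
  obtain ⟨a, ha⟩ := (sum_primeClass_eq_zero_iff hφ A).1 hA
  exact ⟨a, by rw [divisors, ha]; rfl⟩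

lemma sum_divisors (hφ : IsDivisorHom φ) (a : H) : ((divisors φ a).map (primeClass φ)).sum = 0 :=
  (sum_primeClass_eq_zero_iff hφ _).2 ⟨a, rfl⟩

/-- Atoms correspond to minimal zero-sum sequences of classes. -/
lemma irreducible_iff_isMinZeroSum (hφ : IsDivisorHom φ) {u : H} :
    Irreducible u ↔ IsMinZeroSum (primeClass φ) (divisors φ u) := by
  constructor
  · intro hu
    refine ⟨fun h => hu.not_isUnit ((divisors_eq_zero_iff hφ).1 h), sum_divisors hφ u,
      fun T hT hs => ?_⟩
    obtain ⟨a, rfl⟩ := exists_divisors_eq hφ hs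
    obtain ⟨B, hB⟩ := Multiset.le_iff_exists_add.1 hT
    obtain ⟨b, rfl⟩ := hφ a u ⟨Multiplicative.ofAdd B, hB⟩
    rcases hu.isUnit_or_isUnit rfl with h | h
    · exact Or.inl ((divisors_eq_zero_iff hφ).2 h)
    · right
      rw [divisors_mul, (divisors_eq_zero_iff hφ).2 h, add_zero]
  · intro hu
    refine ⟨fun h => hu.1 ((divisors_eq_zero_iff hφ).2 h), fun a b hab => ?_⟩
    subst hab
    rw [divisors_mul] at hu
    rcases hu.3 _ (Multiset.le_add_right _ _) (sum_divisors hφ a) with h | h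
    · exact Or.inl ((divisors_eq_zero_iff hφ).1 h)
    · exact Or.inr ((divisors_eq_zero_iff hφ).1 (by simpa using h))

lemma exists_irreducible (hφ : IsDivisorHom φ) {S : Multiset P}
    (hS : IsMinZeroSum (primeClass φ) S) : ∃ u : H, Irreducible u ∧ divisors φ u = S := by
  obtain ⟨u, rfl⟩ := exists_divisors_eq hφ hS.2
  exact ⟨u, (irreducible_iff_isMinZeroSum hφ).2 hS, rfl⟩

/-- If u has divisor `S` and v has divisor -S, chosen prime by prime through `ν`, then uv is also
the product of the elements with divisors p · ν(p), one for each prime p in `S`. These are atoms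
because a minimal zero-sum sequence of length at least 2 does not contain 0. -/
lemma sharedLengths_two_card (hφ : IsDivisorHom φ)
    (hsymm : primeClasses φ = -primeClasses φ) {S : Multiset P}
    (hS : IsMinZeroSum (primeClass φ) S) (hcard : 2 ≤ Multiset.card S) :
    SharedLengths H 2 (Multiset.card S) := by
  have hneg : ∀ p, ∃ q, primeClass φ q = -primeClass φ p := by
    intro p
    have hp : -primeClass φ p ∈ primeClasses φ := by
      rw [hsymm, Set.neg_mem_neg]; exact ⟨p, rfl⟩
    exact hp
  choose ν hν using hneg
  have hS' : IsMinZeroSum (primeClass φ) (S.map ν) := by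
    rw [isMinZeroSum_map]
    simpa only [hν] using hS.neg
  obtain ⟨u, hu, huS⟩ := exists_irreducible hφ hS
  obtain ⟨v, hv, hvS⟩ := exists_irreducible hφ hS'
  have hw : ∀ p, ∃ w : H, divisors φ w = {p, ν p} := fun p =>
    exists_divisors_eq hφ (by simp [hν])
  choose w hw using hw
  have hne : ∀ p ∈ S, primeClass φ p ≠ 0 := by
    intro p hp h
    rw [hS.eq_singleton hp h] at hcard
    simp at hcard
  have key : Associated ({u, v} : Multiset H).prod (S.map w).prod := by
    refine associated_of_map_eq hφ (Multiplicative.toAdd.injective ?_)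
    change divisors φ _ = divisors φ _
    rw [divisors_prod, divisors_prod, Multiset.map_map]
    simp only [Function.comp_def, hw, Multiset.insert_eq_cons, Multiset.map_cons,
      Multiset.map_singleton, Multiset.sum_cons, Multiset.sum_singleton, huS, hvS]
    clear * -
    induction S using Multiset.induction_on with
    | empty => simp
    | cons p S ih =>
      simp only [Multiset.map_cons, Multiset.sum_cons, ← ih]
      simp only [← Multiset.singleton_add]
      abel
  have := sharedLengths_of_associated (z := {u, v}) (w := S.map w) ?_ ?_ key
  · simpa using this
  · intro x hx
    rcases (by simpa using hx : x = u ∨ x = v) with rfl | rfl <;> assumption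
  · intro x hx
    obtain ⟨p, hp, rfl⟩ := Multiset.mem_map.1 hx
    rw [irreducible_iff_isMinZeroSum hφ, hw]
    exact isMinZeroSum_pair (hne p hp) (by simp [hν])

open Classical in
/-- The weight of `A`: prime divisors count once, principal ones count twice. -/
noncomputable def weight (φ : H →* FreeAbelianMonoid P) (A : Multiset P) : ℕ :=
  (A.map fun p => if primeClass φ p = 0 then 2 else 1).sum

lemma weight_divisors_prod (z : Multiset H) :
    weight φ (divisors φ z.prod) = (z.map fun u => weight φ (divisors φ u)).sum := by
  rw [divisors_prod]
  induction z using Multiset.induction_on with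
  | empty => simp [weight]
  | cons a z ih =>
    simp only [Multiset.map_cons, Multiset.sum_cons, ← ih]
    simp [weight]

/-- The only atoms of length 1 are the principal primes. Doubling their weight makes 2 a lower bound
for the weight of every atom, and D ≥ 2 keeps the upper bound. -/
lemma weight_mem_Icc {D : ℕ} (hD2 : 2 ≤ D)
    (hD : ∀ S, IsMinZeroSum (primeClass φ) S → Multiset.card S ≤ D) {S : Multiset P}
    (hS : IsMinZeroSum (primeClass φ) S) : 2 ≤ weight φ S ∧ weight φ S ≤ D := by
  by_cases h : ∃ p ∈ S, primeClass φ p = 0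
  · obtain ⟨p, hp, h0⟩ := h
    rw [hS.eq_singleton hp h0]
    simpa [weight, h0] using hD2
  · push Not at h
    have hw : weight φ S = Multiset.card S := by
      rw [weight, Multiset.map_congr rfl fun p hp => if_neg (h p hp)]
      simp
    rw [hw]
    refine ⟨?_, hD S hS⟩
    by_contra hcon
    obtain h0 | h1 : Multiset.card S = 0 ∨ Multiset.card S = 1 := by omega
    · exact hS.1 (Multiset.card_eq_zero.1 h0)
    · obtain ⟨p, rfl⟩ := Multiset.card_eq_one.1 h1
      exact h p (by simp) (by simpa using hS.2)

/-- Both factorizations have the same total weight, which is at least 2l and at most kD. -/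
lemma two_mul_le_of_sharedLengths (hφ : IsDivisorHom φ) {D : ℕ} (hD2 : 2 ≤ D)
    (hD : ∀ S, IsMinZeroSum (primeClass φ) S → Multiset.card S ≤ D) {k l : ℕ}
    (h : SharedLengths H k l) : 2 * l ≤ k * D := by
  obtain ⟨a, hk, hl⟩ := h
  obtain ⟨z, hz, hza, rfl⟩ := mem_lengthSet_iff.1 hk
  obtain ⟨w, hw, hwa, rfl⟩ := mem_lengthSet_iff.1 hl
  have heq : divisors φ z.prod = divisors φ w.prod := by
    obtain ⟨x, hx⟩ := hza.trans hwa.symm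
    rw [← hx, divisors_mul, (divisors_eq_zero_iff hφ).2 x.isUnit, add_zero]
  have hwt : ∀ u : H, Irreducible u →
      2 ≤ weight φ (divisors φ u) ∧ weight φ (divisors φ u) ≤ D := fun u hu =>
    weight_mem_Icc hD2 hD ((irreducible_iff_isMinZeroSum hφ).1 hu)
  have h1 : Multiset.card w * 2 ≤ weight φ (divisors φ w.prod) := by
    rw [weight_divisors_prod, ← smul_eq_mul, ← Multiset.card_map (fun u => weight φ (divisors φ u))]
    refine Multiset.card_nsmul_le_sum fun x hx => ?_
    obtain ⟨u, hu, rfl⟩ := Multiset.mem_map.1 hx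
    exact (hwt u (hw u hu)).1
  have h2 : weight φ (divisors φ z.prod) ≤ Multiset.card z * D := by
    rw [weight_divisors_prod, ← smul_eq_mul, ← Multiset.card_map (fun u => weight φ (divisors φ u))]
    refine Multiset.sum_le_card_nsmul _ _ fun x hx => ?_
    obtain ⟨u, hu, rfl⟩ := Multiset.mem_map.1 hx
    exact (hwt u (hz u hu)).2
  rw [heq] at h2
  omega

lemma exists_isMinZeroSum_card_eq_fib (hsymm : primeClasses φ = -primeClasses φ) {r : ℕ}
    (hr : 1 ≤ r) {e : Fin r → DivisorClassGroup φ} (he : LinearIndependent ℤ e)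
    (hcube : hypercubeVertices e ⊆ primeClasses φ) :
    ∃ S, IsMinZeroSum (primeClass φ) S ∧ Multiset.card S = Nat.fib (r + 2) := by
  obtain ⟨S, hS, hcard⟩ := exists_isMinZeroSum_fibVector he
  have h : ∀ n, ∃ p, primeClass φ p = fibVector e n := by
    intro n
    have hn : fibVector e n ∈ primeClasses φ := by
      rcases fibVector_mem hr e n with h | h
      · exact hcube h
      · rw [hsymm]
        exact Set.neg_subset_neg.2 hcube h
    exact hn
  choose p hp using h
  refine ⟨S.map p, ?_, by simpa using hcard⟩
  rw [isMinZeroSum_map]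
  simpa only [hp] using hS

end Transfer

lemma hypercubeVertices_castLE_subset {G : Type*} [AddCommGroup G] {s r : ℕ} (h : s ≤ r)
    (e : Fin r → G) : hypercubeVertices (e ∘ Fin.castLE h) ⊆ hypercubeVertices e := by
  rintro _ ⟨ε, h01, ⟨i, hi⟩, rfl⟩
  refine ⟨fun j => if hj : (j : ℕ) < s then ε ⟨j, hj⟩ else 0, fun j => ?_, ⟨Fin.castLE h i, ?_⟩, ?_⟩
  · dsimp only
    split_ifs with hj
    · exact h01 _
    · exact Or.inl rfl
  · simpa using hi
  · rw [← Finset.sum_subset (Finset.subset_univ (Finset.univ.map (Fin.castLEEmb h)))]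
    · simp
    · intro j _ hj
      have : ¬ (j : ℕ) < s := fun hjs => hj (by
        simp only [Finset.mem_map, Finset.mem_univ, true_and]
        exact ⟨⟨j, hjs⟩, rfl⟩)
      simp [this]

end KrullMonoid

theorem theorem5p3 {H P : Type*} [CancelCommMonoid H]
    (φ : H →* KrullMonoid.FreeAbelianMonoid P) (hφ : KrullMonoid.IsDivisorTheory φ)
    (r : ℕ) (hr : 2 ≤ r)
    (e : Module.Basis (Fin r) ℤ (KrullMonoid.DivisorClassGroup φ))
    (hfin : (KrullMonoid.primeClasses φ).Finite)
    (hsymm : KrullMonoid.primeClasses φ = -KrullMonoid.primeClasses φ)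
    (hcube : KrullMonoid.hypercubeVertices e ⊆ KrullMonoid.primeClasses φ) :
    (∃ M : ℕ, ∀ k : ℕ, 2 ≤ k →
      ∃ (a b : ℤ) (L' L'' : Set ℤ), a ≤ b ∧
        (Nat.cast '' KrullMonoid.unionLengths H k : Set ℤ) = L' ∪ Set.Icc a b ∪ L'' ∧
        L' ⊆ Set.Icc (a - M) (a - 1) ∧ L'' ⊆ Set.Icc (b + 1) (b + M)) ∧
    KrullMonoid.davenport (KrullMonoid.primeClasses φ) ≠ ⊤ ∧
    ∀ k : ℕ, 1 ≤ k →
      KrullMonoid.rho H (2 * k) = k * KrullMonoid.davenport (KrullMonoid.primeClasses φ) ∧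
      (k * Nat.fib (r + 2) : ℕ∞) ≤ k * KrullMonoid.davenport (KrullMonoid.primeClasses φ) ∧
      k * KrullMonoid.davenport (KrullMonoid.primeClasses φ) + 1 ≤
        KrullMonoid.rho H (2 * k + 1) ∧
      (KrullMonoid.rho H (2 * k + 1) : ℝ≥0∞) ≤
        k * (KrullMonoid.davenport (KrullMonoid.primeClasses φ) : ℝ≥0∞) +
          (KrullMonoid.davenport (KrullMonoid.primeClasses φ) : ℝ≥0∞) / 2 := by
  have hdiv := hφ.divisorHom
  obtain ⟨S, hS, hScard⟩ := KrullMonoid.exists_isMinZeroSum_card_eq_fib hsymm (by omega)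
    e.linearIndependent hcube
  -- The first two basis vectors give a minimal zero-sum sequence of length F_4 = 3, the source of
  -- the pair (2, 3).
  obtain ⟨T, hT, hTcard⟩ := KrullMonoid.exists_isMinZeroSum_card_eq_fib hsymm (r := 2) (by omega)
    (e.linearIndependent.comp (Fin.castLE hr) (Fin.castLE_injective hr))
    ((KrullMonoid.hypercubeVertices_castLE_subset hr e).trans hcube)
  replace hTcard : Multiset.card T = 3 := hTcard
  obtain ⟨D, hD, hDmax, V, hV, hVcard⟩ :=
    KrullMonoid.exists_davenport_eq (KrullMonoid.primeClass φ) hfin ⟨S, hS⟩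
  replace hD : KrullMonoid.davenport (KrullMonoid.primeClasses φ) = D := hD
  have hD3 : 3 ≤ D := hTcard ▸ hDmax T hT
  have hU := KrullMonoid.unionLengths_eq
    ((KrullMonoid.exists_irreducible hdiv hS).imp fun _ h => h.1)
  have h1 : KrullMonoid.SharedLengths H 1 1 := by
    obtain ⟨u, hu, -⟩ := KrullMonoid.exists_irreducible hdiv hS
    have := KrullMonoid.sharedLengths_of_associated (z := {u}) (w := {u}) (by simpa using hu)
      (by simpa using hu) (Associated.refl _)
    simpa using this
  have h3 : KrullMonoid.SharedLengths H 2 3 :=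
    hTcard ▸ KrullMonoid.sharedLengths_two_card hdiv hsymm hT (by omega)
  have h2D : KrullMonoid.SharedLengths H 2 D :=
    hVcard ▸ KrullMonoid.sharedLengths_two_card hdiv hsymm hV (by omega)
  have hle : ∀ k l, KrullMonoid.SharedLengths H k l → 2 * l ≤ k * D := fun k l =>
    KrullMonoid.two_mul_le_of_sharedLengths hdiv (by omega) hDmax
  have hmem : ∀ k, KrullMonoid.SharedLengths H (2 * k) (k * D) := fun k => by
    simpa [mul_comm] using
      KrullMonoid.rel_mul KrullMonoid.sharedLengths_zero KrullMonoid.SharedLengths.add h2D k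
  have hrho_le : ∀ k N : ℕ, (∀ l, KrullMonoid.SharedLengths H k l → l ≤ N) →
      KrullMonoid.rho H k ≤ N := by
    intro k N h
    rw [KrullMonoid.rho, hU]
    exact iSup₂_le fun l hl => by exact_mod_cast h l hl
  have hle_rho : ∀ k l : ℕ, KrullMonoid.SharedLengths H k l → (l : ℕ∞) ≤ KrullMonoid.rho H k := by
    intro k l h
    rw [KrullMonoid.rho, hU]
    exact le_iSup₂_of_le l h le_rfl
  refine ⟨?_, by simp [hD], fun k _ => ⟨?_, ?_, ?_, ?_⟩⟩
  · obtain ⟨M, hM⟩ := KrullMonoid.exists_interval_of_rel KrullMonoid.sharedLengths_zero h1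
      (fun _ _ h => h.symm) KrullMonoid.SharedLengths.add h3 hD3 h2D hle
    exact ⟨M, fun k _ => by rw [hU]; exact hM k⟩
  · rw [hD]
    refine le_antisymm ?_ ?_
    · exact_mod_cast hrho_le (2 * k) (k * D) fun l hl => by
        have := hle _ _ hl
        rw [mul_assoc] at this
        omega
    · exact_mod_cast hle_rho _ _ (hmem k)
  · rw [hD]
    have : Nat.fib (r + 2) ≤ D := hScard ▸ hDmax S hS
    exact_mod_cast Nat.mul_le_mul_left k this
  · rw [hD]
    exact_mod_cast hle_rho _ _ (KrullMonoid.SharedLengths.add _ _ _ _ (hmem k) h1)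
  · rw [hD]
    -- Lengths are integers, so the cone gives the floor of (2k + 1)D/2, which is then compared with
    -- the exact quotient.
    have hN : KrullMonoid.rho H (2 * k + 1) ≤ (((2 * k + 1) * D / 2 : ℕ) : ℕ∞) :=
      hrho_le _ _ fun l hl => by
        have := hle _ _ hl
        omega
    refine (ENat.toENNReal_mono hN).trans ?_
    have hsum : (k : ℝ≥0∞) * ((D : ℕ∞) : ℝ≥0∞) + ((D : ℕ∞) : ℝ≥0∞) / 2 =
        (((2 * k + 1) * D : ℕ) : ℝ≥0∞) / 2 := by
      rw [ENat.toENNReal_coe, show (2 * k + 1) * D = k * D * 2 + D by ring]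
      push_cast
      rw [ENNReal.add_div, ENNReal.mul_div_cancel_right (by simp) (by simp)]
    rw [hsum, ENat.toENNReal_coe, ENNReal.le_div_iff_mul_le (by simp) (by simp)]
    exact_mod_cast Nat.div_mul_le_self _ _
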